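/- Let $\rho$ be a continuous finite-dimensional complex representation of $SL(4,\mathbb{R})$ on $V$. For $A\in\mathfrak{sl}(4,\mathbb{R})$ let $d\rho(A)$ be the derivative of $\rho$ along the one-parameter group $\exp(tA)$ at $t=0$. A vector operator is a family $X_0,\dots,X_3$ of linear operators on $V$ with $[d\rho(A),X_\alpha]=\sum_\beta A^{\beta}{}_{\alpha}X_\beta$ for all $A\in\mathfrak{sl}(4,\mathbb{R})$; a vector operator with upper index satisfies $[d\rho(A),X^\alpha]=-\sum_\beta A^{\alpha}{}_{\beta}X^\beta$. For integers $\lambda_1\ge\lambda_2\ge\lambda_3\ge0$, an irreducible representation is labeled $[\lambda_1,\lambda_2,\lambda_3]$ if it has a highest weight vector of weight $(\lambda_1,\lambda_2,\lambda_3,0)$ (a nonzero vector fixed by the upper unitriangular matrices on which $\mathrm{diag}(t_1,t_2,t_3,t_4)$, $t_1t_2t_3t_4=1$, acts by $t_1^{\lambda_1}t_2^{\lambda_2}t_3^{\lambda_3}$). 1. The defining representation on $\mathbb{C}^4$ has label $[1,0,0]$. If $\rho$ is irreducible, then $\rho\otimes[1,0,0]$ contains neither $\rho$ nor its contragredient $g\mapsto\rho(g^{-1})^{T}$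 as a subrepresentation. In terms of labels, if $\rho$ is labeled $[\lambda_1,\lambda_2,\lambda_3]$, then $\rho\otimes[1,0,0]$ contains no finite-dimensional representation labeled $[\lambda_1,\lambda_2,\lambda_3]$ or $[\lambda_1,\lambda_1-\lambda_3,\lambda_1-\lambda_2]$. Now let $V=\bigoplus_i V_i$ be a decomposition into irreducible subrepresentations, with projections $P_i:V\to V_i$. 2. For every vector operator $X$, with lower or upper index, and every $\alpha$, the diagonal blocks $P_iX_\alpha|_{V_i}$ are zero. More generally $P_iX_\alpha|_{V_j}=0$ whenever $V_i$ is equivalent to $V_j$ or to the contragredient of $V_j$. 3. Consider a Dirac-type equation $iX^\alpha\partial_\alpha\Psi=\kappa\Psi$ for fields $\Psi:\mathbb{R}^4\to V$, with a diagonal mass operator $\kappa|_{V_i}=m_i\,\mathrm{id}$, $m_i\in\mathbb{C}$. Suppose that either the operator $iX^\alpha\partial_\alpha-\kappa$ commutes with the action $\Psi(x)\mapsto\rho(g)\Psi(g^{-1}(x-a))$ of the special affine group on smooth fields, or $X^\alpha=c^{\alpha\beta}Y_\beta$ for a vector operator $Y$ (with lower or upper index) and a constant real matrix $c$ (for instance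 the Minkowski metric). Then: (a) if, for some $i$, the equation restricted to $V_i$, that is $P_i\,(iX^\alpha\partial_\alpha\varphi-\kappa\varphi)=0$, has a differentiable solution $\varphi:\mathbb{R}^4\to V_i$ that is not identically zero, then $m_i=0$; hence $\kappa=0$ if this is the case for every $i$; (b) if the full equation has a plane wave solution $\Psi(x)=e^{-ip\cdot x}v$ with $p\in\mathbb{R}^4$, $v\ne0$, then at least one $m_i$ is zero; in particular $\kappa=0$ if all $m_i$ are equal. -/

import Mathlib

open scoped TensorProduct MatrixGroups ContDiff

noncomputable section

namespace SL4

/-- The strong continuity of a representation of `SL(4, ℝ)` on a normed space, where `SL(4, ℝ)`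
carries the topology induced from the space of real `4 × 4` matrices. -/
def IsContinuousRep {V : Type*} [NormedAddCommGroup V] [NormedSpace ℂ V]
    (ρ : Representation ℂ SL(4, ℝ) V) : Prop :=
  ∀ v : V, Continuous fun g : SL(4, ℝ) => ρ g v

/-- The defining (vector) representation of `SL(4, ℝ)` on `ℂ⁴`. -/
def vectorRep : Representation ℂ SL(4, ℝ) (Fin 4 → ℂ) where
  toFun g := Matrix.toLin' ((g : Matrix (Fin 4) (Fin 4) ℝ).map Complex.ofReal)
  map_one' := by
    ext i j
    simp [Matrix.map_one]
  map_mul' g h := by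
    have h1 : ((g * h : SL(4, ℝ)) : Matrix (Fin 4) (Fin 4) ℝ).map Complex.ofReal =
        (g : Matrix (Fin 4) (Fin 4) ℝ).map Complex.ofReal *
          (h : Matrix (Fin 4) (Fin 4) ℝ).map Complex.ofReal := by
      rw [Matrix.SpecialLinearGroup.coe_mul]
      exact Matrix.map_mul (f := Complex.ofRealHom)
    rw [h1, Matrix.toLin'_mul]
    rfl

/-- `σ` is contained in `τ`: it is equivalent to a subrepresentation of `τ`. -/
def Contains {V W : Type*} [AddCommGroup V] [Module ℂ V] [AddCommGroup W] [Module ℂ W]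
    (τ : Representation ℂ SL(4, ℝ) V) (σ : Representation ℂ SL(4, ℝ) W) : Prop :=
  ∃ f : Representation.IntertwiningMap σ τ, Function.Injective f

/-- `ρ` is the irreducible representation with label `[l₁, l₂, l₃]` (row lengths of the Young
diagram): it is irreducible and has a highest weight vector of weight `(l₁, l₂, l₃, 0)`. -/
structure HasLabel {V : Type*} [AddCommGroup V] [Module ℂ V]
    (ρ : Representation ℂ SL(4, ℝ) V) (l₁ l₂ l₃ : ℤ) : Prop where
  irreducible : ρ.IsIrreducible
  third_nonneg : 0 ≤ l₃
  third_le_second : l₃ ≤ l₂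
  second_le_first : l₂ ≤ l₁
  highestWeightVector : ∃ v : V, v ≠ 0 ∧
    (∀ g : SL(4, ℝ), (∀ i, g.1 i i = 1) → (∀ i j, j < i → g.1 i j = 0) → ρ g v = v) ∧
    (∀ g : SL(4, ℝ), (∀ i j, i ≠ j → g.1 i j = 0) →
      ρ g v = (((g.1 0 0) ^ l₁ * (g.1 1 1) ^ l₂ * (g.1 2 2) ^ l₃ : ℝ) : ℂ) • v)

/-- `B` is the operator representing the Lie algebra element `A`: it is the derivative at `0` of
`ρ` along the one-parameter subgroup `γ` of `SL(4, ℝ)` with velocity `A`, i.e. `γ t = exp (t A)`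
(in particular `A` is traceless). -/
def IsGenerator {V : Type*} [NormedAddCommGroup V] [NormedSpace ℂ V]
    (ρ : Representation ℂ SL(4, ℝ) V) (A : Matrix (Fin 4) (Fin 4) ℝ) (B : Module.End ℂ V) :
    Prop :=
  ∃ γ : ℝ → SL(4, ℝ),
    (∀ s t, γ (s + t) = γ s * γ t) ∧
    (∀ i j, HasDerivAt (fun t => (γ t).1 i j) (A i j) 0) ∧
    (∀ v, HasDerivAt (fun t => ρ (γ t) v) (B v) 0)

/-- An `SL(4, ℝ)` vector operator `X_α`: the commutators of the generators with `X_α` are those of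
a basis `e_α` of the vector representation, `[dρ(A), X_α] = ∑ β, A^β_α X_β` for `A ∈ sl(4, ℝ)`. -/
def IsVectorOperator {V : Type*} [NormedAddCommGroup V] [NormedSpace ℂ V]
    (ρ : Representation ℂ SL(4, ℝ) V) (X : Fin 4 → Module.End ℂ V) : Prop :=
  ∀ A B, IsGenerator ρ A B → ∀ α, B * X α - X α * B = ∑ β, (A β α : ℂ) • X β

/-- A vector operator `X^α` with upper index: `[dρ(A), X^α] = - ∑ β, A^α_β X^β`. -/
def IsContravariantVectorOperator {V : Type*} [NormedAddCommGroup V] [NormedSpace ℂ V]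
    (ρ : Representation ℂ SL(4, ℝ) V) (X : Fin 4 → Module.End ℂ V) : Prop :=
  ∀ A B, IsGenerator ρ A B → ∀ α, B * X α - X α * B = - ∑ β, (A α β : ℂ) • X β

/-- The component map onto the `i`-th summand of an internal direct sum. -/
def component {V ι : Type*} [AddCommGroup V] [Module ℂ V] [DecidableEq ι]
    {U : ι → Submodule ℂ V} (hU : DirectSum.IsInternal U) (i : ι) : V →ₗ[ℂ] U i :=
  DirectSum.component ℂ ι (fun k => U k) i ∘ₗ
    (LinearEquiv.ofBijective (DirectSum.coeLinearMap U) hU).symm.toLinearMap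

/-- The `(i, j)` block `U j → U i` of an operator on an internal direct sum. -/
def block {V ι : Type*} [AddCommGroup V] [Module ℂ V] [DecidableEq ι]
    {U : ι → Submodule ℂ V} (hU : DirectSum.IsInternal U) (T : Module.End ℂ V) (i j : ι) :
    U j →ₗ[ℂ] U i :=
  component hU i ∘ₗ T ∘ₗ (U j).subtype

/-- The Dirac-type operator `i X^α ∂_α - κ` applied to a field on `ℝ⁴`. -/
def diracOp {V : Type*} [NormedAddCommGroup V] [NormedSpace ℂ V]
    (X : Fin 4 → Module.End ℂ V) (κ : Module.End ℂ V) (Ψ : (Fin 4 → ℝ) → V) :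
    (Fin 4 → ℝ) → V :=
  fun x => Complex.I • ∑ α, X α (fderiv ℝ Ψ x (Pi.single α 1)) - κ (Ψ x)

/-- The action of the special affine group on fields:
`((g, a) · Ψ)(x) = ρ(g) Ψ(g⁻¹ (x - a))`. -/
def affineAct {V : Type*} [AddCommGroup V] [Module ℂ V]
    (ρ : Representation ℂ SL(4, ℝ) V) (g : SL(4, ℝ)) (a : Fin 4 → ℝ) (Ψ : (Fin 4 → ℝ) → V) :
    (Fin 4 → ℝ) → V :=
  fun x => ρ g (Ψ ((g⁻¹).1.mulVec (x - a)))

/-- The equation `i X^α ∂_α Ψ = κ Ψ` is affine invariant: its operator commutes with the action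
of the special affine group on smooth fields. -/
def IsAffineInvariant {V : Type*} [NormedAddCommGroup V] [NormedSpace ℂ V]
    (ρ : Representation ℂ SL(4, ℝ) V) (X : Fin 4 → Module.End ℂ V) (κ : Module.End ℂ V) : Prop :=
  ∀ (g : SL(4, ℝ)) (a : Fin 4 → ℝ) (Ψ : (Fin 4 → ℝ) → V), ContDiff ℝ ∞ Ψ →
    diracOp X κ (affineAct ρ g a Ψ) = affineAct ρ g a (diracOp X κ Ψ)

end SL4

end

namespace SL4

/-! Everything but the plane wave statement rests on the central element `negOne`. It acts by a sign
`ε` on an irreducible representation (`exists_negOne_smul`), by the same sign on the dual, and by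
`-1` on the vector representation, so tensoring with the latter flips the sign. In terms of labels
the sign is the parity of the number of boxes, which is the same for both labels considered.

For vector operators the commutation relations are integrated along one-parameter groups
(`conj_eq_of_commutator`). Since `-1` lies on such a group (`rotation_pi`), each `X α` anticommutes
with `ρ negOne` and has no block between summands of equal sign. On a single summand the derivative
term therefore drops out, leaving only the mass term.

A plane wave gives `M v = κ v` with `M` a real combination of the components of an equivariant
family. A suitable group element rescales `M` by some `r ≠ 1` (`exists_rescaling`) while commuting
with `κ`. Were `κ` invertible, `κ⁻¹ M` would have all the eigenvalues `r ^ n`, impossible in finite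
dimension (`eq_zero_of_rescaling`). -/

/-! ### The defining representation: irreducibility and label. -/

theorem vectorRep_apply (g : SL(4, ℝ)) (v : Fin 4 → ℂ) (i : Fin 4) :
    vectorRep g v i = ∑ j, (g.1 i j : ℂ) * v j := rfl

theorem vectorRep_transvection {i j : Fin 4} (h : i ≠ j) (v : Fin 4 → ℂ) :
    vectorRep ⟨Matrix.transvection i j 1, Matrix.det_transvection_of_ne i j h 1⟩ v =
      v + v j • Pi.single i 1 := by
  ext k
  have h1 : vectorRep ⟨Matrix.transvection i j 1, Matrix.det_transvection_of_ne i j h 1⟩ v k =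
      ∑ l, (((1 : Matrix (Fin 4) (Fin 4) ℝ) k l : ℂ) + ((Matrix.single i j (1 : ℝ) k l : ℝ) : ℂ)) *
        v l :=
    (vectorRep_apply _ v k).trans
      (Finset.sum_congr rfl fun l _ => by rw [← Complex.ofReal_add]; rfl)
  simp only [h1, add_mul, Finset.sum_add_distrib, Pi.add_apply, Pi.smul_apply, smul_eq_mul]
  congr 1
  · simp [Matrix.one_apply, apply_ite Complex.ofReal, ite_mul]
  · rw [Finset.sum_eq_single j]
    · by_cases hk : k = i
      · subst hk; simp
      · simp [hk, Ne.symm hk]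
    · intro l _ hl
      simp [hl.symm]
    · simp

/-- Subtracting `v` from its image under a transvection leaves a multiple of a basis vector. A
nonzero coordinate `v j` thus yields every `e_i` with `i ≠ j`, and one of these in turn yields
`e_j`. -/
theorem vectorRep_isIrreducible : vectorRep.IsIrreducible := by
  have key (S : Subrepresentation vectorRep) {i j : Fin 4} (h : i ≠ j) {v : Fin 4 → ℂ}
      (hv : v ∈ S.toSubmodule) (hj : v j ≠ 0) : Pi.single i 1 ∈ S.toSubmodule := by
    have h1 := S.apply_mem_toSubmodule
      ⟨Matrix.transvection i j 1, Matrix.det_transvection_of_ne i j h 1⟩ hv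
    rw [vectorRep_transvection h] at h1
    have h2 := S.toSubmodule.smul_mem (v j)⁻¹ (S.toSubmodule.sub_mem h1 hv)
    rwa [add_sub_cancel_left, smul_smul, inv_mul_cancel₀ hj, one_smul] at h2
  have : Nontrivial (Subrepresentation vectorRep) := by
    refine ⟨⊥, ⊤, fun h => ?_⟩
    have h1 : (Pi.single 0 1 : Fin 4 → ℂ) ∈ (⊤ : Subrepresentation vectorRep).toSubmodule :=
      Submodule.mem_top
    rw [← h] at h1
    have h2 : (Pi.single 0 1 : Fin 4 → ℂ) = 0 := (Submodule.mem_bot ℂ).1 h1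
    simpa using congrFun h2 0
  refine ⟨fun S => ?_⟩
  by_cases hS : S.toSubmodule = ⊥
  · exact Or.inl (Subrepresentation.toSubmodule_injective hS)
  · right
    obtain ⟨v, hv, hv0⟩ := Submodule.exists_mem_ne_zero_of_ne_bot hS
    obtain ⟨j, hj⟩ := Function.ne_iff.1 hv0
    have hne (i : Fin 4) (hi : i ≠ j) : (Pi.single i 1 : Fin 4 → ℂ) ∈ S.toSubmodule :=
      key S hi hv hj
    have hall (i : Fin 4) : (Pi.single i 1 : Fin 4 → ℂ) ∈ S.toSubmodule := by
      by_cases hi : i = j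
      · obtain ⟨k, hk⟩ := exists_ne j
        subst hi
        exact key S hk.symm (hne k hk) (by simp)
      · exact hne i hi
    refine Subrepresentation.toSubmodule_injective (top_unique fun w _ => ?_)
    rw [← Finset.univ_sum_single w]
    refine S.toSubmodule.sum_mem fun i _ => ?_
    have := S.toSubmodule.smul_mem (w i) (hall i)
    rwa [← Pi.single_smul, smul_eq_mul, mul_one] at this

theorem hasLabel_vectorRep : HasLabel vectorRep 1 0 0 where
  irreducible := vectorRep_isIrreducible
  third_nonneg := le_rfl
  third_le_second := le_rfl
  second_le_first := zero_le_one
  highestWeightVector := by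
    refine ⟨Pi.single 0 1, by simp, fun g h1 h2 => ?_, fun g h => ?_⟩
    · ext i
      rw [vectorRep_apply, Finset.sum_eq_single 0 (by simp +contextual) (by simp)]
      by_cases hi : i = 0
      · subst hi; simp [h1]
      · simp [h2 i 0 (Fin.pos_of_ne_zero hi), hi]
    · ext i
      rw [vectorRep_apply, Finset.sum_eq_single 0 (by simp +contextual) (by simp)]
      by_cases hi : i = 0
      · subst hi; simp
      · simp [h i 0 hi, hi]

/-! ### The central sign and tensor products with the vector representation. -/

/-- The nontrivial central element `-1` of `SL(4, ℝ)`. -/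
def negOne : SL(4, ℝ) := ⟨-1, by rw [Matrix.det_neg]; norm_num⟩

theorem coe_negOne : negOne.1 = -1 := rfl

theorem negOne_mul_self : negOne * negOne = 1 :=
  Subtype.ext (by rw [Matrix.SpecialLinearGroup.coe_mul, coe_negOne]; simp)

theorem negOne_inv : negOne⁻¹ = negOne := inv_eq_of_mul_eq_one_right negOne_mul_self

theorem negOne_mul_comm (g : SL(4, ℝ)) : negOne * g = g * negOne :=
  Subtype.ext (by simp only [Matrix.SpecialLinearGroup.coe_mul, coe_negOne]; simp)

theorem vectorRep_negOne (v : Fin 4 → ℂ) : vectorRep negOne v = -v := by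
  ext i
  simp [vectorRep_apply, coe_negOne, Matrix.one_apply, apply_ite Complex.ofReal, ite_mul]

section Algebra

variable {V W : Type*} [AddCommGroup V] [Module ℂ V] [AddCommGroup W] [Module ℂ W]
  {ρ : Representation ℂ SL(4, ℝ) V} {σ : Representation ℂ SL(4, ℝ) W}

theorem exists_ne_zero_of_isIrreducible (h : ρ.IsIrreducible) : ∃ v : V, v ≠ 0 := by
  by_contra! hv
  have := h
  refine bot_ne_top (α := Subrepresentation ρ)
    (Subrepresentation.toSubmodule_injective (Submodule.ext fun v => ?_))
  rw [hv v]
  exact ⟨fun _ => Submodule.zero_mem _, fun _ => Submodule.zero_mem _⟩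

/-- The sign by which `-1` acts in an irreducible representation. -/
theorem exists_negOne_smul (h : ρ.IsIrreducible) :
    ∃ ε : ℂ, ε * ε = 1 ∧ ∀ v, ρ negOne v = ε • v := by
  have := h
  have hinv (v : V) : ρ negOne (ρ negOne v) = v := by
    rw [← Module.End.mul_apply, ← map_mul, negOne_mul_self, map_one, Module.End.one_apply]
  have hcomm (g : SL(4, ℝ)) (v : V) : ρ negOne (ρ g v) = ρ g (ρ negOne v) := by
    rw [← Module.End.mul_apply, ← Module.End.mul_apply, ← map_mul, ← map_mul, negOne_mul_comm]
  -- The fixed space of `-1` is invariant by centrality, hence zero or everything.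
  let S : Subrepresentation ρ :=
    { toSubmodule := LinearMap.ker (ρ negOne - 1)
      apply_mem_toSubmodule := fun g v hv => by
        simp only [LinearMap.mem_ker, LinearMap.sub_apply, Module.End.one_apply, sub_eq_zero]
          at hv ⊢
        rw [hcomm, hv] }
  rcases eq_bot_or_eq_top S with hS | hS
  · refine ⟨-1, by norm_num, fun v => ?_⟩
    -- The symmetrization of `v` is fixed by the involution, so here it vanishes.
    have hmem : ρ negOne v + v ∈ S.toSubmodule := by
      simp [S, hinv, add_comm]
    rw [hS] at hmem
    rw [eq_neg_of_add_eq_zero_left ((Submodule.mem_bot ℂ).1 hmem), neg_one_smul]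
  · refine ⟨1, by norm_num, fun v => ?_⟩
    have hmem : v ∈ S.toSubmodule := by rw [hS]; exact Submodule.mem_top
    simpa [S, sub_eq_zero] using hmem

theorem ne_neg_self_of_sq {ε : ℂ} (h : ε * ε = 1) : ε ≠ -ε := by
  intro h1
  have : ε = 0 := by linear_combination h1 / 2
  simp [this] at h

theorem eq_zero_of_smul_eq_neg_smul {ε : ℂ} (h : ε * ε = 1) {v : V} (hv : ε • v = (-ε) • v) :
    v = 0 := by
  by_contra h0
  exact ne_neg_self_of_sq h (smul_left_injective ℂ h0 hv)

theorem tprod_negOne {ε : ℂ} (h : ∀ v, ρ negOne v = ε • v) (x : V ⊗[ℂ] (Fin 4 → ℂ)) :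
    (ρ.tprod vectorRep) negOne x = (-ε) • x := by
  induction x with
  | zero => simp
  | add x y hx hy => rw [map_add, hx, hy, smul_add]
  | tmul v w =>
    rw [Representation.tprod_apply, TensorProduct.map_tmul, h, vectorRep_negOne,
      TensorProduct.tmul_neg, neg_smul, TensorProduct.smul_tmul']

/-- A vector of `σ` on which `-1` acts by the same sign as in `ρ` is killed by every
intertwining map from `σ` to `ρ ⊗ [1, 0, 0]`. -/
theorem not_contains_of_negOne {ε : ℂ} (hε : ε * ε = 1) (h : ∀ v, ρ negOne v = ε • v)
    {w : W} (hw : w ≠ 0) (hσ : σ negOne w = ε • w) :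
    ¬ Contains (ρ.tprod vectorRep) σ := by
  rintro ⟨f, hf⟩
  have h1 : f (σ negOne w) = (ρ.tprod vectorRep) negOne (f w) :=
    LinearMap.congr_fun (f.isIntertwining' negOne) w
  rw [hσ, tprod_negOne h, map_smul] at h1
  exact hw (hf ((eq_zero_of_smul_eq_neg_smul hε h1).trans (map_zero f).symm))

theorem dual_negOne {ε : ℂ} (h : ∀ v, ρ negOne v = ε • v) (f : Module.Dual ℂ V) :
    ρ.dual negOne f = ε • f := by
  ext v
  simp [Representation.dual_apply, negOne_inv, Module.Dual.transpose_apply, h]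

theorem not_contains_self (h : ρ.IsIrreducible) :
    ¬ Contains (ρ.tprod vectorRep) ρ := by
  obtain ⟨ε, hε, hρ⟩ := exists_negOne_smul h
  obtain ⟨v, hv⟩ := exists_ne_zero_of_isIrreducible h
  exact not_contains_of_negOne hε hρ hv (hρ v)

theorem not_contains_dual (h : ρ.IsIrreducible) :
    ¬ Contains (ρ.tprod vectorRep) ρ.dual := by
  obtain ⟨ε, hε, hρ⟩ := exists_negOne_smul h
  obtain ⟨v, hv⟩ := exists_ne_zero_of_isIrreducible h
  have : Nontrivial V := ⟨v, 0, hv⟩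
  obtain ⟨f, hf⟩ := exists_ne (0 : Module.Dual ℂ V)
  exact not_contains_of_negOne hε hρ hf (dual_negOne hρ f)

/-- In the representation labeled `[l₁, l₂, l₃]` the sign of `-1` is the parity of the number of
boxes of the Young diagram. -/
theorem HasLabel.exists_negOne {l₁ l₂ l₃ : ℤ} (h : HasLabel ρ l₁ l₂ l₃) :
    ∃ v : V, v ≠ 0 ∧ ρ negOne v = ((-1 : ℂ) ^ (l₁ + l₂ + l₃)) • v := by
  obtain ⟨v, hv, -, h2⟩ := h.highestWeightVector
  refine ⟨v, hv, ?_⟩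
  rw [h2 negOne fun i j hij => by simp [coe_negOne, hij]]
  simp [coe_negOne, zpow_add₀]

theorem not_contains_of_hasLabel {l₁ l₂ l₃ : ℤ} (hρ : HasLabel ρ l₁ l₂ l₃)
    (hσ : HasLabel σ l₁ l₂ l₃ ∨ HasLabel σ l₁ (l₁ - l₃) (l₁ - l₂)) :
    ¬ Contains (ρ.tprod vectorRep) σ := by
  obtain ⟨ε, hε, h⟩ := exists_negOne_smul hρ.irreducible
  obtain ⟨v, hv, hv'⟩ := hρ.exists_negOne
  have hε' : ε = (-1 : ℂ) ^ (l₁ + l₂ + l₃) := smul_left_injective ℂ hv ((h v).symm.trans hv')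
  rcases hσ with hσ | hσ
  · obtain ⟨w, hw, hw'⟩ := hσ.exists_negOne
    exact not_contains_of_negOne hε h hw (hε' ▸ hw')
  · obtain ⟨w, hw, hw'⟩ := hσ.exists_negOne
    refine not_contains_of_negOne hε h hw ?_
    -- The box counts of the two labels differ by an even number.
    rw [hw', hε', show l₁ + (l₁ - l₃) + (l₁ - l₂) = (l₁ + l₂ + l₃) + 2 * (l₁ - l₂ - l₃) by ring,
      zpow_add₀ (by norm_num), zpow_mul]
    norm_num

end Algebra

/-! ### Blocks of operators on a direct sum of subrepresentations. -/

section Decomposition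

variable {V ι : Type*} [AddCommGroup V] [Module ℂ V] [DecidableEq ι]

theorem component_of_mem {U : ι → Submodule ℂ V} (hU : DirectSum.IsInternal U) {i : ι} {v : V}
    (hv : v ∈ U i) : component hU i v = ⟨v, hv⟩ :=
  hU.ofBijective_coeLinearMap_of_mem hv

theorem component_of_mem_ne {U : ι → Submodule ℂ V} (hU : DirectSum.IsInternal U) {i j : ι}
    (hij : i ≠ j) {v : V} (hv : v ∈ U i) : component hU j v = 0 :=
  hU.ofBijective_coeLinearMap_of_mem_ne hij hv

theorem induction_of_isInternal {U : ι → Submodule ℂ V} (hU : DirectSum.IsInternal U)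
    {p : V → Prop} (h : ∀ i, ∀ v ∈ U i, p v) (h0 : p 0) (hadd : ∀ v w, p v → p w → p (v + w))
    (v : V) : p v :=
  Submodule.iSup_induction U (motive := p) (hU.submodule_iSup_eq_top ▸ Submodule.mem_top) h h0 hadd

theorem eq_zero_of_component_eq_zero {U : ι → Submodule ℂ V} (hU : DirectSum.IsInternal U) {v : V}
    (h : ∀ i, component hU i v = 0) : v = 0 := by
  have h1 : (LinearEquiv.ofBijective (DirectSum.coeLinearMap U) hU).symm v = 0 :=
    DirectSum.ext_component ℂ fun i => (h i).trans (map_zero _).symm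
  simpa using h1

variable {ρ : Representation ℂ SL(4, ℝ) V} {U : ι → Subrepresentation ρ}

theorem component_apply_rep (hU : DirectSum.IsInternal fun i => (U i).toSubmodule)
    (g : SL(4, ℝ)) (i : ι) (v : V) :
    (component hU i (ρ g v) : V) = ρ g (component hU i v) := by
  refine induction_of_isInternal hU (p := fun v => (component hU i (ρ g v) : V) =
    ρ g (component hU i v)) (fun j v hv => ?_) (by simp)
    (fun v w hv hw => by simp [hv, hw]) v
  have hgv := (U j).apply_mem_toSubmodule g hv
  by_cases hij : j = i
  · subst hij
    rw [component_of_mem hU hv, component_of_mem hU hgv]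
  · rw [component_of_mem_ne hU hij hv, component_of_mem_ne hU hij hgv]
    simp

/-- An operator anticommuting with `ρ (-1)` has no block between summands on which `-1` acts by the
same sign. -/
theorem block_eq_zero_of_anticommute (hU : DirectSum.IsInternal fun i => (U i).toSubmodule)
    {T : Module.End ℂ V}
    (hT : ∀ v, ρ negOne (T v) = -T (ρ negOne v)) {ε : ℂ} (hε : ε * ε = 1) {i j : ι}
    (hi : ∀ v, (U i).toRepresentation negOne v = ε • v)
    (hj : ∀ v, (U j).toRepresentation negOne v = ε • v) : block hU T i j = 0 := by
  ext u
  have hu : ρ negOne (u : V) = ε • (u : V) := congrArg Subtype.val (hj u)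
  set c := component hU i (T u) with hc
  have h1 : ρ negOne (c : V) = ε • (c : V) := congrArg Subtype.val (hi c)
  have h2 := component_apply_rep hU negOne i (T u)
  -- The component `c` has sign `ε` by membership in `U i`, and sign `-ε` by anticommutation.
  rw [hT, hu, ← hc, h1] at h2
  simp only [map_neg, map_smul] at h2
  rw [← hc] at h2
  refine eq_zero_of_smul_eq_neg_smul hε ?_
  rw [neg_smul]
  exact h2.symm

theorem block_eq_zero_of_equiv_or_dual (hU : DirectSum.IsInternal fun i => (U i).toSubmodule)
    (hirr : ∀ i, (U i).toRepresentation.IsIrreducible)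
    {T : Module.End ℂ V} (hT : ∀ v, ρ negOne (T v) = -T (ρ negOne v)) {i j : ι}
    (hij : Nonempty ((U i).toRepresentation.Equiv (U j).toRepresentation) ∨
      Nonempty ((U i).toRepresentation.Equiv (U j).toRepresentation.dual)) :
    block hU T i j = 0 := by
  obtain ⟨ε, hε, hj⟩ := exists_negOne_smul (hirr j)
  refine block_eq_zero_of_anticommute hU hT hε (fun v => ?_) hj
  rcases hij with ⟨⟨e⟩⟩ | ⟨⟨e⟩⟩
  · have h1 : e.toLinearEquiv ((U i).toRepresentation negOne v) =
      (U j).toRepresentation negOne (e.toLinearEquiv v) :=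
      LinearMap.congr_fun (e.toIntertwiningMap.isIntertwining' negOne) v
    rw [hj, ← map_smul] at h1
    exact e.toLinearEquiv.injective h1
  · have h1 : e.toLinearEquiv ((U i).toRepresentation negOne v) =
      (U j).toRepresentation.dual negOne (e.toLinearEquiv v) :=
      LinearMap.congr_fun (e.toIntertwiningMap.isIntertwining' negOne) v
    rw [dual_negOne hj, ← map_smul] at h1
    exact e.toLinearEquiv.injective h1

theorem block_self_eq_zero (hU : DirectSum.IsInternal fun i => (U i).toSubmodule)
    (hirr : ∀ i, (U i).toRepresentation.IsIrreducible)
    {T : Module.End ℂ V} (hT : ∀ v, ρ negOne (T v) = -T (ρ negOne v)) (i : ι) :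
    block hU T i i = 0 := by
  obtain ⟨ε, hε, hi⟩ := exists_negOne_smul (hirr i)
  exact block_eq_zero_of_anticommute hU hT hε hi hi

/-- An operator acting by scalars on the summands commutes with the representation. -/
theorem rep_comm_of_scalar (hU : DirectSum.IsInternal fun i => (U i).toSubmodule)
    {κ : Module.End ℂ V} {m : ι → ℂ}
    (hκ : ∀ i, ∀ v ∈ U i, κ v = m i • v) (g : SL(4, ℝ)) (v : V) : κ (ρ g v) = ρ g (κ v) := by
  refine induction_of_isInternal hU (p := fun v => κ (ρ g v) = ρ g (κ v)) (fun i v hv => ?_)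
    (by simp) (fun v w hv hw => by simp [hv, hw]) v
  rw [hκ i v hv, hκ i _ ((U i).apply_mem_toSubmodule g hv), map_smul]

theorem component_scalar (hU : DirectSum.IsInternal fun i => (U i).toSubmodule)
    {κ : Module.End ℂ V} {m : ι → ℂ}
    (hκ : ∀ i, ∀ v ∈ U i, κ v = m i • v) (i : ι) (v : V) :
    component hU i (κ v) = m i • component hU i v := by
  refine induction_of_isInternal hU (p := fun v => component hU i (κ v) =
    m i • component hU i v) (fun j v hv => ?_) (by simp)
    (fun v w hv hw => by simp [hv, hw]) v
  rw [hκ j v hv, map_smul]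
  by_cases hij : j = i
  · rw [hij]
  · rw [component_of_mem_ne hU hij hv, smul_zero, smul_zero]

theorem injective_of_scalar (hU : DirectSum.IsInternal fun i => (U i).toSubmodule)
    {κ : Module.End ℂ V} {m : ι → ℂ}
    (hκ : ∀ i, ∀ v ∈ U i, κ v = m i • v) (hm : ∀ i, m i ≠ 0) : Function.Injective κ := by
  rw [injective_iff_map_eq_zero]
  intro v hv
  refine eq_zero_of_component_eq_zero hU fun i => ?_
  have := component_scalar hU hκ i v
  rw [hv, map_zero] at this
  exact (smul_eq_zero.1 this.symm).resolve_left (hm i)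

theorem eq_zero_of_scalar (hU : DirectSum.IsInternal fun i => (U i).toSubmodule)
    {κ : Module.End ℂ V} {m : ι → ℂ}
    (hκ : ∀ i, ∀ v ∈ U i, κ v = m i • v) (hm : ∀ i, m i = 0) : κ = 0 := by
  ext v
  refine eq_zero_of_component_eq_zero hU fun i => ?_
  rw [component_scalar hU hκ, hm, zero_smul]

end Decomposition

/-- If `T` rescales `M` by a factor which is not a root of unity and commutes with an injective
`κ`, then `κ⁻¹ M` has no eigenvalue `1`. -/
theorem eq_zero_of_rescaling {V : Type*} [AddCommGroup V] [Module ℂ V] [FiniteDimensional ℂ V]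
    {T M κ : Module.End ℂ V} {r : ℝ} (hr : 0 < r) (hr1 : r ≠ 1)
    (hT : Function.Injective T) (hTM : ∀ v, M (T v) = (r : ℂ) • T (M v))
    (hTκ : ∀ v, κ (T v) = T (κ v)) (hκ : Function.Injective κ) {v : V} (hv : M v = κ v) :
    v = 0 := by
  by_contra h0
  let e := LinearEquiv.ofInjectiveEndo κ hκ
  let N : Module.End ℂ V := e.symm.toLinearMap ∘ₗ M
  have hiter (n : ℕ) : M ((T ^ n) v) = ((r ^ n : ℝ) : ℂ) • κ ((T ^ n) v) := by
    induction n with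
    | zero => simp [hv]
    | succ n ih =>
      rw [pow_succ', Module.End.mul_apply, hTM, ih, map_smul, hTκ, smul_smul, pow_succ']
      push_cast
      rfl
  have hne (n : ℕ) : (T ^ n) v ≠ 0 := by
    rw [Module.End.coe_pow]
    intro h
    exact h0 (hT.iterate n (h.trans (by rw [← Module.End.coe_pow, map_zero])))
  -- Each application of `T` to the solution multiplies the eigenvalue by `r`; injectivity of `T`
  -- keeps the vectors nonzero.
  have heig (n : ℕ) : N.HasEigenvalue ((r ^ n : ℝ) : ℂ) := by
    refine Module.End.hasEigenvalue_of_hasEigenvector (x := (T ^ n) v)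
      ⟨Module.End.mem_eigenspace_iff.2 ?_, hne n⟩
    change e.symm (M ((T ^ n) v)) = _
    rw [hiter, map_smul]
    congr 1
    exact e.symm_apply_apply _
  have hinj : Function.Injective fun n : ℕ => ((r ^ n : ℝ) : ℂ) := fun a b hab =>
    pow_right_injective₀ hr hr1 (Complex.ofReal_injective hab)
  exact Set.infinite_of_injective_forall_mem hinj heig N.finite_hasEigenvalue

/-! ### One-parameter groups in Banach algebras. -/

section OneParameter

variable {A : Type*} [NormedRing A] [NormedAlgebra ℝ A]

/-- A continuous one-parameter group in a Banach algebra is differentiable. -/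
theorem exists_hasDerivAt_of_continuous [CompleteSpace A] {f : ℝ → A} (hf : Continuous f)
    (h0 : f 0 = 1) (hadd : ∀ s t, f (s + t) = f s * f t) : ∃ B, HasDerivAt f B 0 := by
  let F : ℝ → A := fun a => ∫ s in (0 : ℝ)..a, f s
  have hF (t : ℝ) : HasDerivAt F (f t) t :=
    intervalIntegral.integral_hasDerivAt_right (hf.intervalIntegrable _ _)
      hf.aestronglyMeasurable.stronglyMeasurableAtFilter hf.continuousAt
  have hlim := (hasDerivAt_iff_tendsto_slope_zero.1 (hF 0))
  simp only [zero_add, h0] at hlim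
  have hF0 : F 0 = 0 := intervalIntegral.integral_same
  -- The averages of `f` over `[0, a]` tend to `f 0 = 1` and units form an open set, so some average
  -- is invertible.
  have hunit : ∀ᶠ a in nhdsWithin (0 : ℝ) {0}ᶜ, IsUnit (a⁻¹ • (F a - F 0)) :=
    hlim.eventually (Units.isOpen.mem_nhds isUnit_one)
  obtain ⟨a, ⟨u, hu⟩, ha⟩ := (hunit.and self_mem_nhdsWithin).exists
  have hmul (t : ℝ) : f t * (a⁻¹ • (F a - F 0)) = a⁻¹ • (F (t + a) - F t) := by
    rw [hF0, sub_zero, mul_smul_comm]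
    congr 1
    have h1 : F (t + a) - F t = ∫ s in t..(t + a), f s :=
      intervalIntegral.integral_interval_sub_left (hf.intervalIntegrable _ _)
        (hf.intervalIntegrable _ _)
    have h2 : ∫ s in (0 : ℝ)..a, f (t + s) = ∫ s in t..(t + a), f s := by
      rw [intervalIntegral.integral_comp_add_left (fun s => f s), add_zero]
    rw [h1, ← h2]
    simp only [hadd, F]
    exact ((ContinuousLinearMap.mul ℝ A (f t)).intervalIntegral_comp_comm
      (hf.intervalIntegrable 0 a)).symm
  -- Dividing by the invertible average expresses `f` through its own primitive, which is
  -- differentiable.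
  have hf' : f = fun t => (a⁻¹ • (F (t + a) - F t)) * (↑u⁻¹ : A) := by
    ext t
    rw [← hmul, ← hu, mul_assoc, Units.mul_inv, mul_one]
  rw [hf']
  exact ⟨_, ((((hF (0 + a)).comp_add_const 0 a).sub (hF 0)).const_smul a⁻¹).mul_const _⟩

theorem hasDerivAt_of_hasDerivAt_zero {f : ℝ → A} (hadd : ∀ s t, f (s + t) = f s * f t) {B : A}
    (hB : HasDerivAt f B 0) (t : ℝ) : HasDerivAt f (f t * B) t := by
  have h1 : HasDerivAt f B (t - t) := by rwa [sub_self]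
  have h2 := (h1.comp_sub_const t t).const_mul (f t)
  refine h2.congr_of_eventuallyEq (Filter.Eventually.of_forall fun s => ?_)
  change f s = f t * f (s - t)
  rw [← hadd, add_sub_cancel]

theorem hasDerivAt_of_hasDerivAt_zero' {f : ℝ → A} (hadd : ∀ s t, f (s + t) = f s * f t) {B : A}
    (hB : HasDerivAt f B 0) (t : ℝ) : HasDerivAt f (B * f t) t := by
  have h1 : HasDerivAt f B (t - t) := by rwa [sub_self]
  have h2 := (h1.comp_sub_const t t).mul_const (f t)
  refine h2.congr_of_eventuallyEq (Filter.Eventually.of_forall fun s => ?_)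
  change f s = f (s - t) * f t
  rw [← hadd, sub_add_cancel]

/-- Integrating the commutation relations `[B, X_α] = ∑ β, D^β_α X_β` along one-parameter groups. -/
theorem conj_eq_of_commutator {n : Type*} [Fintype n] [DecidableEq n] {f : ℝ → A} (h0 : f 0 = 1)
    (hadd : ∀ s t, f (s + t) = f s * f t) {B : A} (hB : HasDerivAt f B 0)
    {c : ℝ → Matrix n n ℝ} (hc0 : c 0 = 1) (hcadd : ∀ s t, c (s + t) = c s * c t)
    {D : Matrix n n ℝ} (hD : ∀ i j, HasDerivAt (fun t => c t i j) (D i j) 0)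
    {X : n → A} (hX : ∀ i, B * X i - X i * B = ∑ j, D j i • X j) (t : ℝ) (i : n) :
    f t * X i = ∑ j, c t j i • (X j * f t) := by
  have hc' (t : ℝ) (j i : n) : HasDerivAt (fun t => c t j i) (∑ k, D j k * c t k i) t := by
    have h1 (k : n) : HasDerivAt (fun s => c (s - t) j k) (D j k) t := by
      have h2 : HasDerivAt (fun s => c s j k) (D j k) (t - t) := by rw [sub_self]; exact hD j k
      exact h2.comp_sub_const t t
    have h3 := HasDerivAt.fun_sum (u := Finset.univ) fun k _ => (h1 k).mul_const (c t k i)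
    refine h3.congr_of_eventuallyEq (Filter.Eventually.of_forall fun s => ?_)
    change c s j i = ∑ k, c (s - t) j k * c t k i
    rw [← Matrix.mul_apply, ← hcadd, sub_add_cancel]
  have hneg (t : ℝ) : HasDerivAt (fun t : ℝ => -t) (-1) t := hasDerivAt_neg t
  -- Conjugation by `f t` contributes the commutator, expressed through `D`; differentiating `c
  -- (-t)` contributes the same with opposite sign.
  have hder (t : ℝ) : HasDerivAt (fun t => ∑ j, c (-t) j i • (f t * X j * f (-t))) 0 t := by
    have h1 (j : n) := (((hc' (-t) j i).comp t (hneg t)).smul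
      (((hasDerivAt_of_hasDerivAt_zero hadd hB t).mul_const (X j)).mul
        ((hasDerivAt_of_hasDerivAt_zero' hadd hB (-t)).scomp t (hneg t))))
    have h2 := HasDerivAt.fun_sum (u := Finset.univ) fun j _ => h1 j
    refine h2.congr_deriv ?_
    have h3 (j : n) : f t * B * X j * f (-t) + f t * X j * ((-1 : ℝ) • (B * f (-t))) =
        ∑ k, D k j • (f t * X k * f (-t)) := by
      have : f t * B * X j * f (-t) + f t * X j * ((-1 : ℝ) • (B * f (-t))) =
          f t * (B * X j - X j * B) * f (-t) := by
        rw [neg_one_smul]; noncomm_ring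
      rw [this, hX, Finset.mul_sum, Finset.sum_mul]
      simp only [mul_smul_comm, smul_mul_assoc]
    simp only [Function.comp_apply, h3, Finset.sum_add_distrib, Finset.smul_sum, smul_smul]
    rw [Finset.sum_comm, ← Finset.sum_add_distrib]
    refine Finset.sum_eq_zero fun j _ => ?_
    rw [← Finset.sum_smul]
    change _ + _ • (f t * X j * f (-t)) = 0
    rw [← add_smul, mul_neg_one]
    simp [mul_comm]
  -- The constant is compared at `-t` and `0`, so that left multiplication by `f t` gives the claim.
  have hconst := is_const_of_deriv_eq_zero (fun t => (hder t).differentiableAt)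
    (fun t => (hder t).deriv) (-t) 0
  simp only [neg_zero, neg_neg, h0, hc0, one_mul, mul_one, Matrix.one_apply, ite_smul, one_smul,
    zero_smul, Finset.sum_ite_eq', Finset.mem_univ, if_true] at hconst
  rw [← hconst, Finset.mul_sum]
  refine Finset.sum_congr rfl fun j _ => ?_
  rw [mul_smul_comm, ← mul_assoc, ← mul_assoc, ← hadd, add_neg_cancel, h0, one_mul]

end OneParameter

/-! ### From commutators to finite transformation laws. -/

/-- A differentiable one-parameter subgroup of `SL(4, ℝ)`. -/
structure IsOneParameterGroup (γ : ℝ → SL(4, ℝ)) : Prop where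
  continuous : Continuous γ
  map_add : ∀ s t, γ (s + t) = γ s * γ t
  hasDerivAt : ∃ A : Matrix (Fin 4) (Fin 4) ℝ,
    ∀ i j, HasDerivAt (fun t => (γ t).1 i j) (A i j) 0

theorem IsOneParameterGroup.map_zero {γ : ℝ → SL(4, ℝ)} (hγ : IsOneParameterGroup γ) :
    γ 0 = 1 := by
  have := hγ.map_add 0 0
  rwa [add_zero, left_eq_mul] at this

theorem IsOneParameterGroup.inv {γ : ℝ → SL(4, ℝ)} (hγ : IsOneParameterGroup γ) (t : ℝ) :
    (γ t)⁻¹ = γ (-t) :=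
  inv_eq_of_mul_eq_one_right (by rw [← hγ.map_add, add_neg_cancel, hγ.map_zero])

/-- The finite transformation law of a vector operator along one-parameter subgroups. -/
def IsEquivariant {V : Type*} [AddCommGroup V] [Module ℂ V]
    (ρ : Representation ℂ SL(4, ℝ) V) (X : Fin 4 → Module.End ℂ V) : Prop :=
  ∀ γ, IsOneParameterGroup γ → ∀ t i v,
    ρ (γ t) (X i v) = ∑ j, ((γ t).1 j i : ℂ) • X j (ρ (γ t) v)

/-- The finite transformation law of a vector operator with upper index along one-parameter
subgroups. -/
def IsContravariantEquivariant {V : Type*} [AddCommGroup V] [Module ℂ V]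
    (ρ : Representation ℂ SL(4, ℝ) V) (X : Fin 4 → Module.End ℂ V) : Prop :=
  ∀ γ, IsOneParameterGroup γ → ∀ t i v,
    ρ (γ t) (X i v) = ∑ j, ((γ (-t)).1 i j : ℂ) • X j (ρ (γ t) v)

section Generators

variable {V : Type*} [NormedAddCommGroup V] [NormedSpace ℂ V] [FiniteDimensional ℂ V]
  {ρ : Representation ℂ SL(4, ℝ) V}

/-- In finite dimension strong continuity is norm continuity, so the Banach algebra result applies.
-/
theorem IsOneParameterGroup.exists_hasDerivAt_rep {γ : ℝ → SL(4, ℝ)}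
    (hγ : IsOneParameterGroup γ) (hρ : IsContinuousRep ρ) :
    ∃ B : V →L[ℂ] V,
      HasDerivAt (fun t => Module.End.toContinuousLinearMap V (ρ (γ t))) B 0 := by
  have := FiniteDimensional.complete ℂ V
  refine exists_hasDerivAt_of_continuous ?_ (by simp [hγ.map_zero])
    (fun s t => by rw [hγ.map_add, map_mul, map_mul])
  rw [continuous_clm_apply]
  exact fun v => (hρ v).comp hγ.continuous

/-- A vector operator transforms by matrices `c t` whose generator `D` gives its commutators. -/
theorem rep_apply_of_commutator (hρ : IsContinuousRep ρ) {γ : ℝ → SL(4, ℝ)}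
    (hγ : IsOneParameterGroup γ) {A D : Matrix (Fin 4) (Fin 4) ℝ}
    (hA : ∀ i j, HasDerivAt (fun t => (γ t).1 i j) (A i j) 0)
    {c : ℝ → Matrix (Fin 4) (Fin 4) ℝ} (hc0 : c 0 = 1) (hcadd : ∀ s t, c (s + t) = c s * c t)
    (hD : ∀ i j, HasDerivAt (fun t => c t i j) (D i j) 0) {X : Fin 4 → Module.End ℂ V}
    (hX : ∀ B, IsGenerator ρ A B → ∀ i, B * X i - X i * B = ∑ j, (D j i : ℂ) • X j)
    (t : ℝ) (i : Fin 4) (v : V) :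
    ρ (γ t) (X i v) = ∑ j, (c t j i : ℂ) • X j (ρ (γ t) v) := by
  obtain ⟨B, hB⟩ := hγ.exists_hasDerivAt_rep hρ
  have hgen : IsGenerator ρ A (B : V →ₗ[ℂ] V) :=
    ⟨γ, hγ.map_add, hA, fun v =>
      (((ContinuousLinearMap.apply ℂ V v).restrictScalars ℝ).hasFDerivAt.comp_hasDerivAt 0 hB :)⟩
  let Φ : Module.End ℂ V ≃ₐ[ℂ] (V →L[ℂ] V) := Module.End.toContinuousLinearMap V
  have hΦ (T : Module.End ℂ V) (v : V) : Φ T v = T v := rfl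
  have hXΦ (i : Fin 4) : B * Φ (X i) - Φ (X i) * B = ∑ j, D j i • Φ (X j) := by
    ext v
    have := LinearMap.congr_fun (hX _ hgen i) v
    simpa [hΦ] using this
  have h := conj_eq_of_commutator (f := fun t => Φ (ρ (γ t))) (by simp [hγ.map_zero])
    (fun s t => by rw [hγ.map_add, map_mul, map_mul]) hB hc0 hcadd hD hXΦ t i
  have := DFunLike.congr_fun h v
  simpa [hΦ] using this

theorem IsVectorOperator.isEquivariant (hρ : IsContinuousRep ρ) {X : Fin 4 → Module.End ℂ V}
    (hX : IsVectorOperator ρ X) : IsEquivariant ρ X := by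
  intro γ hγ t i v
  obtain ⟨A, hA⟩ := hγ.hasDerivAt
  exact rep_apply_of_commutator hρ hγ hA (c := fun t => (γ t).1) (by simp [hγ.map_zero])
    (fun s t => by simp [hγ.map_add]) hA (hX A) t i v

theorem IsContravariantVectorOperator.isContravariantEquivariant (hρ : IsContinuousRep ρ)
    {X : Fin 4 → Module.End ℂ V} (hX : IsContravariantVectorOperator ρ X) :
    IsContravariantEquivariant ρ X := by
  intro γ hγ t i v
  obtain ⟨A, hA⟩ := hγ.hasDerivAt
  -- Upper indices transform by the inverse transpose, whose velocity is `-Aᵀ`.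
  refine rep_apply_of_commutator hρ hγ hA (c := fun t => (γ (-t)).1.transpose) (D := -A.transpose)
    (by simp [hγ.map_zero]) (fun s t => ?_) (fun i j => ?_) (fun B hB i => ?_) t i v
  · rw [← Matrix.transpose_mul, ← Matrix.SpecialLinearGroup.coe_mul, ← hγ.map_add, neg_add_rev]
  · have h1 : HasDerivAt (fun t => (γ t).1 j i) (A j i) (-0) := by rw [neg_zero]; exact hA j i
    exact (h1.comp 0 (hasDerivAt_neg 0)).congr_deriv (by simp)
  · rw [hX A B hB i]
    simp

end Generators

theorem isOneParameterGroup_of_entries {γ : ℝ → SL(4, ℝ)}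
    (hadd : ∀ s t, γ (s + t) = γ s * γ t)
    (hd : ∀ i j, Differentiable ℝ fun t => (γ t).1 i j) : IsOneParameterGroup γ where
  continuous := continuous_induced_rng.2
    (continuous_matrix fun i j => (hd i j).continuous)
  map_add := hadd
  hasDerivAt := ⟨fun i j => deriv (fun t => (γ t).1 i j) 0, fun i j => (hd i j 0).hasDerivAt⟩

/-! ### Explicit one-parameter groups: rotations reaching `-1`, and stretchings. -/

/-- The simultaneous rotation in two orthogonal planes. -/
noncomputable def rotation (t : ℝ) : SL(4, ℝ) :=
  ⟨!![Real.cos t, -Real.sin t, 0, 0; Real.sin t, Real.cos t, 0, 0;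
      0, 0, Real.cos t, -Real.sin t; 0, 0, Real.sin t, Real.cos t], by
    simp [Matrix.det_succ_row_zero, Fin.sum_univ_succ, Fin.succAbove]
    -- The determinant is `(cos² + sin²)²`; subtracting `1` leaves a difference of squares.
    linear_combination (1 + Real.cos t ^ 2 + Real.sin t ^ 2) * Real.sin_sq_add_cos_sq t⟩

theorem isOneParameterGroup_rotation : IsOneParameterGroup rotation := by
  refine isOneParameterGroup_of_entries (fun s t => ?_) (fun i j => ?_)
  · refine Subtype.ext ?_
    rw [Matrix.SpecialLinearGroup.coe_mul]
    simp only [rotation]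
    ext i j
    fin_cases i <;> fin_cases j <;>
      simp [Matrix.mul_apply, Fin.sum_univ_succ, Real.cos_add, Real.sin_add] <;> ring
  · fin_cases i <;> fin_cases j <;> simp [rotation]

/-- This makes `-1` accessible to hypotheses on the Lie algebra alone. -/
theorem rotation_pi : rotation Real.pi = negOne := by
  refine Subtype.ext ?_
  simp only [rotation, negOne]
  ext i j
  fin_cases i <;> fin_cases j <;> simp

/-- The rank one orthogonal projection onto the line of `q`. -/
noncomputable def lineProj (q : Fin 4 → ℝ) : Matrix (Fin 4) (Fin 4) ℝ := (q ⬝ᵥ q)⁻¹ • Matrix.vecMulVec q q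

theorem lineProj_mul_self {q : Fin 4 → ℝ} (hq : q ≠ 0) : lineProj q * lineProj q = lineProj q := by
  have h : q ⬝ᵥ q ≠ 0 := fun h => hq (dotProduct_self_eq_zero.1 h)
  simp only [lineProj, Matrix.smul_mul, Matrix.mul_smul, Matrix.vecMulVec_mul_vecMulVec, smul_smul,
    Matrix.vecMulVec_smul]
  congr 1
  field_simp

theorem lineProj_apply_comm (q : Fin 4 → ℝ) (i j : Fin 4) : lineProj q i j = lineProj q j i := by
  simp [lineProj, Matrix.vecMulVec_apply, mul_comm]

theorem lineProj_mulVec {q : Fin 4 → ℝ} (hq : q ≠ 0) (i : Fin 4) :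
    ∑ j, lineProj q i j * q j = q i := by
  have h : q ⬝ᵥ q ≠ 0 := fun h => hq (dotProduct_self_eq_zero.1 h)
  have h1 : ∑ j, lineProj q i j * q j = (q ⬝ᵥ q)⁻¹ * (q i * (q ⬝ᵥ q)) := by
    simp only [lineProj, Matrix.smul_apply, Matrix.vecMulVec_apply, smul_eq_mul, dotProduct,
      Finset.mul_sum, mul_assoc]
  rw [h1]
  field_simp

theorem det_one_add_smul_lineProj {q : Fin 4 → ℝ} (hq : q ≠ 0) (a : ℝ) :
    (1 + a • lineProj q).det = 1 + a := by
  have h : q ⬝ᵥ q ≠ 0 := fun h => hq (dotProduct_self_eq_zero.1 h)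
  have h1 : a • lineProj q = Matrix.replicateCol Unit ((a * (q ⬝ᵥ q)⁻¹) • q) *
      Matrix.replicateRow Unit q := by
    rw [← Matrix.vecMulVec_eq, lineProj, smul_smul, Matrix.smul_vecMulVec]
  rw [h1, Matrix.det_one_add_replicateCol_mul_replicateRow, dotProduct_smul, smul_eq_mul]
  field_simp

/-- The one-parameter group stretching the line of `q` and shrinking its orthogonal complement. -/
noncomputable def stretch {q : Fin 4 → ℝ} (hq : q ≠ 0) (t : ℝ) : SL(4, ℝ) :=
  -- The factors are `exp (3t)` on the line and `exp (-t)` on its three-dimensional complement, with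
  -- product `1`.
  ⟨Real.exp (-t) • (1 + (Real.exp (4 * t) - 1) • lineProj q), by
    rw [Matrix.det_smul, det_one_add_smul_lineProj hq, Fintype.card_fin, ← Real.exp_nat_mul,
      add_sub_cancel, ← Real.exp_add]
    norm_num⟩

theorem stretch_apply {q : Fin 4 → ℝ} (hq : q ≠ 0) (t : ℝ) (i j : Fin 4) :
    (stretch hq t).1 i j = Real.exp (-t) *
      ((1 : Matrix (Fin 4) (Fin 4) ℝ) i j + (Real.exp (4 * t) - 1) * lineProj q i j) := rfl

theorem isOneParameterGroup_stretch {q : Fin 4 → ℝ} (hq : q ≠ 0) :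
    IsOneParameterGroup (stretch hq) := by
  refine isOneParameterGroup_of_entries (fun s t => ?_) (fun i j => ?_)
  · refine Subtype.ext ?_
    rw [Matrix.SpecialLinearGroup.coe_mul]
    simp only [stretch]
    rw [Matrix.smul_mul, Matrix.mul_smul, smul_smul, ← Real.exp_add, neg_add, mul_add, Real.exp_add (4 * s)]
    simp only [add_mul, mul_add, Matrix.smul_mul, Matrix.mul_smul, lineProj_mul_self hq, mul_one,
      one_mul]
    congr 1
    module
  · simp only [stretch_apply]
    fun_prop

/-- Symmetry lets the same group serve for lower and upper indices, whose laws differ by a transpose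
and an inverse. -/
theorem stretch_apply_comm {q : Fin 4 → ℝ} (hq : q ≠ 0) (t : ℝ) (i j : Fin 4) :
    (stretch hq t).1 i j = (stretch hq t).1 j i := by
  rw [stretch_apply, stretch_apply, lineProj_apply_comm, Matrix.one_apply, Matrix.one_apply]
  simp [eq_comm]

theorem stretch_mulVec {q : Fin 4 → ℝ} (hq : q ≠ 0) (t : ℝ) (i : Fin 4) :
    ∑ j, (stretch hq t).1 i j * q j = Real.exp (3 * t) * q i := by
  have h1 : ∑ j, (stretch hq t).1 i j * q j = Real.exp (-t) *
      (∑ j, (1 : Matrix (Fin 4) (Fin 4) ℝ) i j * q j +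
        (Real.exp (4 * t) - 1) * ∑ j, lineProj q i j * q j) := by
    simp only [stretch_apply, Finset.mul_sum, ← Finset.sum_add_distrib]
    exact Finset.sum_congr rfl fun j _ => by ring
  rw [h1, lineProj_mulVec hq]
  have h2 : Real.exp (3 * t) = Real.exp (-t) * Real.exp (4 * t) := by
    rw [← Real.exp_add]; ring_nf
  simp only [Matrix.one_apply, ite_mul, one_mul, zero_mul, Finset.sum_ite_eq, Finset.mem_univ,
    if_true, h2]
  ring

/-! ### Anticommutation with `-1` and rescaling of vector operators. -/

section

variable {V : Type*} [AddCommGroup V] [Module ℂ V] {ρ : Representation ℂ SL(4, ℝ) V}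
  {X : Fin 4 → Module.End ℂ V}

theorem IsEquivariant.anticommute (hX : IsEquivariant ρ X) (i : Fin 4) (v : V) :
    ρ negOne (X i v) = -X i (ρ negOne v) := by
  have h := hX rotation isOneParameterGroup_rotation Real.pi i v
  rw [rotation_pi] at h
  rw [h]
  simp [coe_negOne, Matrix.one_apply, apply_ite Complex.ofReal, ite_smul]

theorem IsContravariantEquivariant.anticommute (hX : IsContravariantEquivariant ρ X) (i : Fin 4)
    (v : V) : ρ negOne (X i v) = -X i (ρ negOne v) := by
  have h := hX rotation isOneParameterGroup_rotation Real.pi i v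
  rw [← isOneParameterGroup_rotation.inv, rotation_pi, negOne_inv] at h
  rw [h]
  simp [coe_negOne, Matrix.one_apply, apply_ite Complex.ofReal, ite_smul]

/-- An eigenvector `q` of the transformation matrix makes the combination with coefficients `q` an
eigenvector for conjugation by `T`. -/
theorem sum_smul_rescaling {q : Fin 4 → ℝ} {S : Matrix (Fin 4) (Fin 4) ℝ} {r : ℝ}
    (hS : ∀ i, ∑ j, S i j * q j = r * q i) {T : Module.End ℂ V}
    (hX : ∀ i v, T (X i v) = ∑ j, (S j i : ℂ) • X j (T v)) (v : V) :
    T (∑ i, (q i : ℂ) • X i v) = (r : ℂ) • ∑ i, (q i : ℂ) • X i (T v) := by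
  simp only [map_sum, map_smul, hX, Finset.smul_sum, smul_smul]
  rw [Finset.sum_comm]
  refine Finset.sum_congr rfl fun j _ => ?_
  rw [← Finset.sum_smul, ← Complex.ofReal_mul, ← hS j, Complex.ofReal_sum]
  simp only [Complex.ofReal_mul, mul_comm]

/-- Every real linear combination of the components of a vector operator, with lower or upper
index, is rescaled nontrivially by some element of the group. -/
theorem exists_rescaling (hX : IsEquivariant ρ X ∨ IsContravariantEquivariant ρ X)
    (q : Fin 4 → ℝ) : ∃ (g : SL(4, ℝ)) (r : ℝ), 0 < r ∧ r ≠ 1 ∧ ∀ v,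
      ∑ i, (q i : ℂ) • X i (ρ g v) = (r : ℂ) • ρ g (∑ i, (q i : ℂ) • X i v) := by
  by_cases hq : q = 0
  -- The combination is zero, so any factor serves.
  · exact ⟨1, 2, by norm_num, by norm_num, fun v => by simp [hq]⟩
  have key (t : ℝ) (ht : t ≠ 0) (g : SL(4, ℝ))
      (h : ∀ i v, ρ g (X i v) = ∑ j, ((stretch hq t).1 j i : ℂ) • X j (ρ g v)) :
      ∃ (g : SL(4, ℝ)) (r : ℝ), 0 < r ∧ r ≠ 1 ∧ ∀ v,
        ∑ i, (q i : ℂ) • X i (ρ g v) = (r : ℂ) • ρ g (∑ i, (q i : ℂ) • X i v) := by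
    refine ⟨g, (Real.exp (3 * t))⁻¹, by positivity, ?_, fun v => ?_⟩
    · rw [Ne, inv_eq_one, Real.exp_eq_one_iff]
      simpa using ht
    · rw [sum_smul_rescaling (stretch_mulVec hq t) h, smul_smul, ← Complex.ofReal_mul,
        inv_mul_cancel₀ (Real.exp_ne_zero _), Complex.ofReal_one, one_smul]
  rcases hX with hX | hX
  · exact key 1 one_ne_zero (stretch hq 1)
      fun i v => hX _ (isOneParameterGroup_stretch hq) 1 i v
  -- With upper index the element at time `1` acts through the matrix at time `-1`.
  · refine key (-1) (by norm_num) (stretch hq 1) fun i v => ?_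
    rw [hX _ (isOneParameterGroup_stretch hq) 1 i v]
    exact Finset.sum_congr rfl fun j _ => by rw [stretch_apply_comm]

end

/-! ### The Dirac-type operator on linear fields, plane waves and single summands. -/

section Dirac

variable {V : Type*} [NormedAddCommGroup V] [NormedSpace ℂ V] {ρ : Representation ℂ SL(4, ℝ) V}
  {X : Fin 4 → Module.End ℂ V} {κ : Module.End ℂ V}

theorem diracOp_of_hasFDerivAt {Ψ : (Fin 4 → ℝ) → V} {Ψ' : (Fin 4 → ℝ) →L[ℝ] V}
    {x : Fin 4 → ℝ} (h : HasFDerivAt Ψ Ψ' x) :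
    diracOp X κ Ψ x = Complex.I • ∑ i, X i (Ψ' (Pi.single i 1)) - κ (Ψ x) := by
  rw [diracOp, h.fderiv]

theorem diracOp_linear (l : (Fin 4 → ℝ) →L[ℝ] ℝ) (v : V) :
    diracOp X κ (fun x => l x • v) 0 =
      Complex.I • ∑ i, (l (Pi.single i 1) : ℂ) • X i v := by
  have h : HasFDerivAt (fun x => l x • v) (l.smulRight v) 0 := (l.smulRight v).hasFDerivAt
  rw [diracOp_of_hasFDerivAt h]
  simp

/-- Invariance is tested on the field `x ↦ x i • v` at the origin: the mass term vanishes there and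
the derivative isolates `X i v`. -/
theorem IsAffineInvariant.rep_apply (h : IsAffineInvariant ρ X κ) (g : SL(4, ℝ)) (i : Fin 4)
    (v : V) : ρ g (X i v) = ∑ j, ((g⁻¹).1 i j : ℂ) • X j (ρ g v) := by
  let l : (Fin 4 → ℝ) →L[ℝ] ℝ := ContinuousLinearMap.proj i
  let l' : (Fin 4 → ℝ) →L[ℝ] ℝ :=
    LinearMap.toContinuousLinearMap (LinearMap.proj i ∘ₗ (g⁻¹).1.mulVecLin)
  have h1 := congrFun (h g 0 (fun x => l x • v) (l.smulRight v).contDiff) 0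
  have h2 : affineAct ρ g 0 (fun x => l x • v) = fun x => l' x • ρ g v := by
    ext x
    simp [affineAct, l, l']
  have h3 : affineAct ρ g 0 (diracOp X κ fun x => l x • v) 0 =
      ρ g (diracOp X κ (fun x => l x • v) 0) := by
    simp [affineAct]
  rw [h2, h3, diracOp_linear, diracOp_linear, map_smul] at h1
  have h4 := (smul_right_injective V Complex.I_ne_zero h1).symm
  simpa [l, l', Pi.single_apply, apply_ite Complex.ofReal, ite_smul] using h4

theorem IsAffineInvariant.isContravariantEquivariant (h : IsAffineInvariant ρ X κ) :
    IsContravariantEquivariant ρ X := fun γ hγ t i v => by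
  rw [h.rep_apply, hγ.inv]

theorem diracOp_planeWave (p : Fin 4 → ℝ) (v : V) :
    diracOp X κ (fun y => Complex.exp (-Complex.I * ((∑ α, p α * y α : ℝ) : ℂ)) • v) 0 =
      ∑ i, (p i : ℂ) • X i v - κ v := by
  let l : (Fin 4 → ℝ) →L[ℝ] ℂ :=
    ∑ i, (-Complex.I * (p i : ℂ)) • Complex.ofRealCLM.comp (ContinuousLinearMap.proj i)
  have hl (y : Fin 4 → ℝ) : -Complex.I * ((∑ α, p α * y α : ℝ) : ℂ) = l y := by
    simp [l, Finset.mul_sum, mul_assoc]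
  simp only [hl]
  have h1 := (l.hasFDerivAt (x := 0)).cexp.smul_const v
  rw [diracOp_of_hasFDerivAt h1]
  have h2 (i : Fin 4) : l (Pi.single i 1) = -Complex.I * (p i : ℂ) := by
    rw [← hl]
    simp [Pi.single_apply]
  simp [h2, Finset.smul_sum, smul_smul, ← mul_assoc]

variable {ι : Type*} [DecidableEq ι] [FiniteDimensional ℂ V] {U : ι → Submodule ℂ V}

/-- The projection onto `U i` is continuous and fixes `φ`, so it fixes the derivative too. -/
theorem fderiv_mem (hU : DirectSum.IsInternal U) {i : ι} {φ : (Fin 4 → ℝ) → V}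
    (hφ : Differentiable ℝ φ) (hφU : ∀ x, φ x ∈ U i) (x w : Fin 4 → ℝ) :
    fderiv ℝ φ x w ∈ U i := by
  let L : V →L[ℝ] V := (LinearMap.toContinuousLinearMap
    ((U i).subtype ∘ₗ component hU i)).restrictScalars ℝ
  have h1 : (fun y => L (φ y)) = φ := by
    ext y
    simp [L, component_of_mem hU (hφU y)]
  have h2 : HasFDerivAt (fun y => L (φ y)) (L.comp (fderiv ℝ φ x)) x :=
    L.hasFDerivAt.comp x (hφ x).hasFDerivAt
  rw [h1] at h2
  rw [h2.fderiv]
  exact (component hU i (fderiv ℝ φ x w)).2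

/-- The vanishing diagonal blocks remove the derivative term, so `m • φ x = 0` at a point where `φ x
≠ 0`. -/
theorem mass_eq_zero_of_solution (hU : DirectSum.IsInternal U) {i : ι}
    (hX : ∀ α, block hU (X α) i i = 0) {m : ℂ} (hκ : ∀ v ∈ U i, κ v = m • v)
    {φ : (Fin 4 → ℝ) → V} (hφ : Differentiable ℝ φ) (hφU : ∀ x, φ x ∈ U i) (hφ0 : φ ≠ 0)
    (h : ∀ x, component hU i (diracOp X κ φ x) = 0) : m = 0 := by
  obtain ⟨x, hx⟩ := Function.ne_iff.1 hφ0
  have h1 := h x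
  have h2 (α : Fin 4) : component hU i (X α (fderiv ℝ φ x (Pi.single α 1))) = 0 :=
    LinearMap.congr_fun (hX α) ⟨_, fderiv_mem hU hφ hφU x (Pi.single α 1)⟩
  simp only [diracOp, map_sub, map_smul, map_sum, h2, Finset.sum_const_zero, smul_zero, zero_sub,
    hκ _ (hφU x), component_of_mem hU (hφU x), neg_eq_zero] at h1
  exact (smul_eq_zero.1 h1).resolve_right fun h3 => hx (congrArg Subtype.val h3)

end Dirac

/-! ### Plane waves and the mass spectrum. -/

section Mass

variable {V ι : Type*} [NormedAddCommGroup V] [NormedSpace ℂ V] [FiniteDimensional ℂ V]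
  [DecidableEq ι] {ρ : Representation ℂ SL(4, ℝ) V}

theorem isEquivariant_or_contravariant (hρ : IsContinuousRep ρ) {X : Fin 4 → Module.End ℂ V}
    (hX : IsVectorOperator ρ X ∨ IsContravariantVectorOperator ρ X) :
    IsEquivariant ρ X ∨ IsContravariantEquivariant ρ X :=
  hX.imp (fun h => h.isEquivariant hρ) fun h => h.isContravariantEquivariant hρ

theorem anticommute_of_equivariant {V : Type*} [AddCommGroup V] [Module ℂ V]
    {ρ : Representation ℂ SL(4, ℝ) V} {X : Fin 4 → Module.End ℂ V}
    (hX : IsEquivariant ρ X ∨ IsContravariantEquivariant ρ X) (i : Fin 4) (v : V) :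
    ρ negOne (X i v) = -X i (ρ negOne v) :=
  hX.elim (fun h => h.anticommute i v) fun h => h.anticommute i v

/-- In both cases of the invariance hypothesis the coefficients of the Dirac operator are real
combinations of the components of an equivariant family. -/
theorem exists_equivariant (hρ : IsContinuousRep ρ) {X : Fin 4 → Module.End ℂ V}
    {κ : Module.End ℂ V} (h : IsAffineInvariant ρ X κ ∨
      ∃ (Y : Fin 4 → Module.End ℂ V) (c : Matrix (Fin 4) (Fin 4) ℝ),
        (IsVectorOperator ρ Y ∨ IsContravariantVectorOperator ρ Y) ∧
        ∀ α, X α = ∑ β, (c α β : ℂ) • Y β) :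
    ∃ (Y : Fin 4 → Module.End ℂ V) (c : Matrix (Fin 4) (Fin 4) ℝ),
      (IsEquivariant ρ Y ∨ IsContravariantEquivariant ρ Y) ∧
      ∀ α, X α = ∑ β, (c α β : ℂ) • Y β := by
  rcases h with h | ⟨Y, c, hY, hc⟩
  · refine ⟨X, 1, Or.inr h.isContravariantEquivariant, fun α => ?_⟩
    simp [Matrix.one_apply, apply_ite Complex.ofReal, ite_smul]
  · exact ⟨Y, c, isEquivariant_or_contravariant hρ hY, hc⟩

variable {U : ι → Subrepresentation ρ} {X Y : Fin 4 → Module.End ℂ V} {κ : Module.End ℂ V}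
  {c : Matrix (Fin 4) (Fin 4) ℝ} {m : ι → ℂ}

theorem exists_mass_eq_zero_of_planeWave
    (hU : DirectSum.IsInternal fun i => (U i).toSubmodule)
    (hY : IsEquivariant ρ Y ∨ IsContravariantEquivariant ρ Y)
    (hX : ∀ α, X α = ∑ β, (c α β : ℂ) • Y β) (hκ : ∀ i, ∀ v ∈ U i, κ v = m i • v)
    {p : Fin 4 → ℝ} {v : V} (hv : v ≠ 0) (h : ∑ α, (p α : ℂ) • X α v = κ v) :
    ∃ i, m i = 0 := by
  by_contra! hm
  -- The matrix `c` is absorbed into the momentum. Its entries are real, so `q` is a real vector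
  -- that can be stretched.
  let q : Fin 4 → ℝ := fun β => ∑ α, p α * c α β
  let M : Module.End ℂ V := ∑ β, (q β : ℂ) • Y β
  obtain ⟨g, r, hr, hr1, hg⟩ := exists_rescaling hY q
  have hM (w : V) : M w = ∑ β, (q β : ℂ) • Y β w := by simp [M]
  have hMX (w : V) : ∑ α, (p α : ℂ) • X α w = M w := by
    simp only [hX, hM, q, LinearMap.sum_apply, LinearMap.smul_apply, Finset.smul_sum, smul_smul,
      Complex.ofReal_sum, Complex.ofReal_mul, Finset.sum_smul]
    exact Finset.sum_comm
  have hinj : Function.Injective (ρ g) := fun a b hab => by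
    have := congrArg (ρ g⁻¹) hab
    simpa using this
  exact hv (eq_zero_of_rescaling hr hr1 hinj (fun w => by rw [hM, hM, hg])
    (rep_comm_of_scalar hU hκ g) (injective_of_scalar hU hκ hm) ((hMX v).symm.trans h))

end Mass

end SL4

theorem mainTheorem3 {V W ι : Type*}
    [NormedAddCommGroup V] [NormedSpace ℂ V] [FiniteDimensional ℂ V]
    [AddCommGroup W] [Module ℂ W] [FiniteDimensional ℂ W] [DecidableEq ι]
    (ρ : Representation ℂ SL(4, ℝ) V) (hρ : SL4.IsContinuousRep ρ)
    (σ : Representation ℂ SL(4, ℝ) W) :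
    -- the vector representation is the one with label `[1, 0, 0]`
    SL4.HasLabel SL4.vectorRep 1 0 0 ∧
    -- for irreducible `D`, `D ⊗ [1, 0, 0]` contains neither `D` nor its contragredient
    (ρ.IsIrreducible →
      ¬ SL4.Contains (ρ.tprod SL4.vectorRep) ρ ∧
      ¬ SL4.Contains (ρ.tprod SL4.vectorRep) ρ.dual) ∧
    -- the same in terms of labels
    (∀ l₁ l₂ l₃ : ℤ, SL4.HasLabel ρ l₁ l₂ l₃ →
      (SL4.HasLabel σ l₁ l₂ l₃ ∨ SL4.HasLabel σ l₁ (l₁ - l₃) (l₁ - l₂)) →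
      ¬ SL4.Contains (ρ.tprod SL4.vectorRep) σ) ∧
    -- decompositions into irreducible representations
    (∀ (U : ι → Subrepresentation ρ)
      (hU : DirectSum.IsInternal fun i => (U i).toSubmodule),
      (∀ i, (U i).toRepresentation.IsIrreducible) →
      -- the diagonal blocks of a vector operator vanish, and so do the blocks between
      -- equivalent or mutually contragredient components
      (∀ X : Fin 4 → Module.End ℂ V,
        (SL4.IsVectorOperator ρ X ∨ SL4.IsContravariantVectorOperator ρ X) →
        (∀ α i, SL4.block hU (X α) i i = 0) ∧
        (∀ α i j,
          (Nonempty ((U i).toRepresentation.Equiv (U j).toRepresentation) ∨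
            Nonempty ((U i).toRepresentation.Equiv (U j).toRepresentation.dual)) →
          SL4.block hU (X α) i j = 0)) ∧
      -- Dirac-type equations `i X^α ∂_α Ψ = κ Ψ` with diagonal mass operator `κ`
      (∀ (X : Fin 4 → Module.End ℂ V) (κ : Module.End ℂ V) (m : ι → ℂ),
        (SL4.IsAffineInvariant ρ X κ ∨
          ∃ (Y : Fin 4 → Module.End ℂ V) (c : Matrix (Fin 4) (Fin 4) ℝ),
            (SL4.IsVectorOperator ρ Y ∨ SL4.IsContravariantVectorOperator ρ Y) ∧
            ∀ α, X α = ∑ β, (c α β : ℂ) • Y β) →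
        (∀ i, ∀ v ∈ U i, κ v = m i • v) →
        -- a nonzero solution of the equation restricted to a component forces its mass to vanish
        (∀ i, (∃ φ : (Fin 4 → ℝ) → V, Differentiable ℝ φ ∧ (∀ x, φ x ∈ U i) ∧ φ ≠ 0 ∧
            ∀ x, SL4.component hU i (SL4.diracOp X κ φ x) = 0) → m i = 0) ∧
        -- hence `κ = 0` if every component carries such a solution
        ((∀ i, ∃ φ : (Fin 4 → ℝ) → V, Differentiable ℝ φ ∧ (∀ x, φ x ∈ U i) ∧ φ ≠ 0 ∧
            ∀ x, SL4.component hU i (SL4.diracOp X κ φ x) = 0) → κ = 0) ∧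
        -- a nonzero plane wave solution of the full equation excludes that all masses are
        -- nonzero, and forces `κ = 0` if all masses are equal
        (∀ (p : Fin 4 → ℝ) (v : V), v ≠ 0 →
          (∀ x, SL4.diracOp X κ
            (fun y => Complex.exp (-Complex.I * ((∑ α, p α * y α : ℝ) : ℂ)) • v) x = 0) →
          (∃ i, m i = 0) ∧ ((∀ i j, m i = m j) → κ = 0)))) := by
  refine ⟨SL4.hasLabel_vectorRep, fun h => ⟨SL4.not_contains_self h, SL4.not_contains_dual h⟩,
    fun l₁ l₂ l₃ => SL4.not_contains_of_hasLabel, fun U hU hirr => ⟨fun X hX => ?_,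
      fun X κ m hX hκ => ?_⟩⟩
  · have hanti := SL4.anticommute_of_equivariant (SL4.isEquivariant_or_contravariant hρ hX)
    exact ⟨fun α i => SL4.block_self_eq_zero hU hirr (hanti α) i,
      fun α i j => SL4.block_eq_zero_of_equiv_or_dual hU hirr (hanti α)⟩
  · obtain ⟨Y, c, hY, hXY⟩ := SL4.exists_equivariant hρ hX
    have hanti (α : Fin 4) (v : V) : ρ SL4.negOne (X α v) = -X α (ρ SL4.negOne v) := by
      simp [hXY, SL4.anticommute_of_equivariant hY]
    have hmass (i : ι) (h : ∃ φ : (Fin 4 → ℝ) → V, Differentiable ℝ φ ∧ (∀ x, φ x ∈ U i) ∧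
        φ ≠ 0 ∧ ∀ x, SL4.component hU i (SL4.diracOp X κ φ x) = 0) : m i = 0 := by
      obtain ⟨φ, hφ, hφU, hφ0, h⟩ := h
      exact SL4.mass_eq_zero_of_solution hU
        (fun α => SL4.block_self_eq_zero hU hirr (hanti α) i) (hκ i) hφ hφU hφ0 h
    refine ⟨hmass, fun h => SL4.eq_zero_of_scalar hU hκ fun i => hmass i (h i),
      fun p v hv h => ?_⟩
    -- At the origin the exponential is `1`, and the equation there already reads `∑ p α • X α v = κ
    -- v`.
    have h0 := h 0
    rw [SL4.diracOp_planeWave, sub_eq_zero] at h0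
    obtain ⟨i, hi⟩ := SL4.exists_mass_eq_zero_of_planeWave hU hY hXY hκ hv h0
    exact ⟨⟨i, hi⟩, fun hm => SL4.eq_zero_of_scalar hU hκ fun j => (hm j i).trans hi⟩
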